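/- Let $k\ge 2$ and $j\ge 0$ be integers. A $k$-colored partition of $n$ is a $k$-tuple $(\pi^{(1)},\dots,\pi^{(k)})$ of (possibly empty) partitions whose sizes add up to $n$; its $k$-crank is $\ell(\pi^{(1)})-\ell(\pi^{(2)})$, where $\ell(\pi)$ is the number of parts of $\pi$. Let $M_k(m,n)$ be the number of $k$-colored partitions of $n$ with $k$-crank $m$, and put $$\mu_{2j,k}(-1,n):=\sum_{m=-n}^{n}\binom{m+j-1}{2j}(-1)^m M_k(m,n),$$ where $\binom{x}{r}=x(x-1)\cdots(x-r+1)/r!$ for every integer $x$. Write $(a;q)_\infty=\prod_{i\ge 0}(1-aq^i)$. Then the following identities hold as identities of formal power series in $q$ with integer coefficients, and the multiple sums on the right converge (coefficientwise): $$\sum_{n=0}^{\infty}\mu_{2j,k}(-1,n)q^n=\frac{1}{(q;q)_\infty^{k-2}(-q;q)_\infty^{2}}\sum_{n_j\ge n_{j-1}\ge\cdots\ge n_1\ge 1}\frac{(-1)^j q^{n_1+n_2+\cdots+n_j}}{(1+q^{n_1})^2(1+q^{n_2})^2\cdots(1+q^{n_j})^2}$$ and $$\sum_{n=0}^{\infty}\mu_{2j,k}(-1,n)q^n=\frac{1}{(q;q)_\infty^{k-2}(-q;q)_\infty^{2}}\sum_{m_j>m_{j-1}>\cdots>m_1\ge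 1}\frac{(-1)^{m_j}\,m_1(m_2-m_1)\cdots(m_j-m_{j-1})\,q^{m_j}}{(1-q^{m_1})(1-q^{m_2})\cdots(1-q^{m_j})}.$$ For $j=0$ each multiple sum has the single term $1$ (the empty tuple, with $m_0=0$). -/

import Mathlib

open scoped PowerSeries PowerSeries.WithPiTopology

namespace KCrank

/-- A `k`-colored partition of `n`: a `k`-tuple of partitions whose sizes `c 0, …, c (k - 1)`
add up to `n` (empty partitions are allowed). -/
abbrev ColoredPartition (k n : ℕ) : Type :=
  Σ c : {c : Fin k → ℕ // c ∈ Finset.Nat.antidiagonalTuple k n}, ∀ i : Fin k, (c.1 i).Partition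

/-- The `k`-crank (`k ≥ 2`) of a `k`-colored partition: the number of parts of its first component
minus the number of parts of its second component. -/
def crank {k : ℕ} (hk : 2 ≤ k) {n : ℕ} (π : ColoredPartition k n) : ℤ :=
  ((π.2 ⟨0, by omega⟩).parts.card : ℤ) - ((π.2 ⟨1, by omega⟩).parts.card : ℤ)

/-- `M_k(m,n)`: the number of `k`-colored partitions of `n` with `k`-crank `m`. -/
def crankCount {k : ℕ} (hk : 2 ≤ k) (m : ℤ) (n : ℕ) : ℕ :=
  Fintype.card {π : ColoredPartition k n // crank hk π = m}

/-- `μ_{2j,k}(-1,n)`: the `2j`-th symmetrized `k`-crank moment weighted by the parity of the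
`k`-crank. `Ring.choose` is the generalized binomial coefficient
`x (x - 1) ⋯ (x - r + 1) / r!`, for every integer `x`. -/
noncomputable def moment (j : ℕ) {k : ℕ} (hk : 2 ≤ k) (n : ℕ) : ℤ :=
  ∑ m ∈ Finset.Icc (-(n : ℤ)) (n : ℤ),
    Ring.choose (m + (j : ℤ) - 1) (2 * j) * (m.negOnePow : ℤ) * (crankCount hk m n : ℤ)

/-- `(a;q)_∞ = ∏_{i ≥ 0} (1 - a q^i)` as a formal power series in `q = X`. The product is taken in
the topology of coefficientwise (eventually constant) convergence. -/
noncomputable def qPochInf (a : ℤ⟦X⟧) : ℤ⟦X⟧ :=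
  ∏' i : ℕ, (1 - a * PowerSeries.X ^ i)

/-- The infinite product that defines `(a;q)_∞` converges. -/
theorem multipliable_qPochInf (a : ℤ⟦X⟧) :
    Multipliable fun i : ℕ => (1 - a * PowerSeries.X ^ i : ℤ⟦X⟧) := by
  simp_rw [sub_eq_add_neg]
  apply PowerSeries.WithPiTopology.multipliable_one_add_of_tendsto_order_atTop_nhds_top
  refine ENat.tendsto_nhds_top_iff_natCast_lt.mpr
    (fun n => Filter.eventually_atTop.mpr ⟨n + 1, fun m hm => ?_⟩)
  rw [PowerSeries.order_neg]
  refine lt_of_lt_of_le ?_ (PowerSeries.le_order_mul _ _)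
  rw [PowerSeries.order_X_pow]
  refine lt_of_lt_of_le ?_ le_add_self
  exact_mod_cast hm

/-- The factor `1 / ((q;q)_∞^{k-2} (-q;q)_∞^2)`, for `k ≥ 2`. `Ring.inverse` is the inverse in the
ring `ℤ⟦X⟧`, here of a series with constant term `1`. -/
noncomputable def prefactor (k : ℕ) : ℤ⟦X⟧ :=
  Ring.inverse (qPochInf PowerSeries.X ^ (k - 2) * qPochInf (-PowerSeries.X) ^ 2)

/-- The tuples `n_j ≥ ⋯ ≥ n_1 ≥ 1`; the entry `n_i` is the value at index `i - 1`. -/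
abbrev WeakTuple (j : ℕ) : Type :=
  {n : Fin j → ℕ // Monotone n ∧ ∀ i, 1 ≤ n i}

/-- The tuples `m_j > ⋯ > m_1 ≥ 1`; the entry `m_i` is the value at index `i - 1`. -/
abbrev StrictTuple (j : ℕ) : Type :=
  {m : Fin j → ℕ // StrictMono m ∧ ∀ i, 1 ≤ m i}

/-- `(-1)^j q^{n_1 + ⋯ + n_j} / ((1 + q^{n_1})^2 ⋯ (1 + q^{n_j})^2)`. -/
noncomputable def weakTerm {j : ℕ} (n : Fin j → ℕ) : ℤ⟦X⟧ :=
  (-1) ^ j * PowerSeries.X ^ (∑ i, n i) *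
    Ring.inverse (∏ i, (1 + PowerSeries.X ^ n i) ^ 2)

/-- The tuple `(m_0, m_1, …, m_j)` with `m_0 = 0` prepended. -/
def consZero {j : ℕ} (m : Fin j → ℕ) : Fin (j + 1) → ℕ :=
  Fin.cons 0 m

/-- `(-1)^{m_j} m_1 (m_2 - m_1) ⋯ (m_j - m_{j-1}) q^{m_j} / ((1 - q^{m_1}) ⋯ (1 - q^{m_j}))`,
where `m_0 = 0`, so that the first factor is `m_1 - m_0`, and so that the term is `1` for
`j = 0`. -/
noncomputable def strictTerm {j : ℕ} (m : Fin j → ℕ) : ℤ⟦X⟧ :=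
  (-1) ^ consZero m (Fin.last j) *
    (∏ i : Fin j, ((consZero m i.succ : ℤ⟦X⟧) - (consZero m i.castSucc : ℤ⟦X⟧))) *
    PowerSeries.X ^ consZero m (Fin.last j) *
    Ring.inverse (∏ i, (1 - PowerSeries.X ^ m i))

end KCrank

namespace KCrank

open PowerSeries

/-! The two multiple sums agree because both are iterated sums of one double series. Expand each
weak factor by `y / (1 - y)^2 = ∑ b y^b` (`b ≥ 1`) at `y = -q^n`, and write the weak tuple through
its successive differences `d`. Summation by parts (`sum_mul_weakOfDiff`) turns the exponent into
`m_j + ∑ d_l m_{j+1-l}`, where the `m_i` are the partial sums of the `b`'s. Summing over `d` first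
then gives geometric series, hence the strict sum.

For the moments, apply the linear functional `z^m ↦ (-1)^m binom(m + j - 1, 2j)` to the crank
generating function `∏ 1 / ((1 - z q^n)(1 - z⁻¹ q^n))`. The Euler factor depends on `z` only through
`z + z⁻¹`, and by Pascal's rule multiplication by `z + z⁻¹` sends the functional of index `j + 1` to
minus (twice itself plus the one of index `j`). Truncating the product at `n ≤ N` therefore yields
the recursion of the complete homogeneous sums in `-q^n / (1 + q^n)^2` (`crankMap_crankProd`). Let
`N` tend to infinity; the other `k - 2` colors only contribute `1 / (q;q)_∞^{k-2}`. -/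

/-! ### Inverses, summability and geometric series -/

theorem ringInverse_eq_of_mul_eq_one {R : Type*} [CommRing R] {a b : R} (h : a * b = 1) :
    Ring.inverse a = b := by
  have ha : IsUnit a := IsUnit.of_mul_eq_one b h
  calc Ring.inverse a = Ring.inverse a * (a * b) := by rw [h, mul_one]
    _ = b := Ring.inverse_mul_cancel_left a b ha

theorem isUnit_one_add_X_pow {n : ℕ} (hn : 1 ≤ n) : IsUnit (1 + X ^ n : ℤ⟦X⟧) := by
  rw [PowerSeries.isUnit_iff_constantCoeff]
  simp [Nat.one_le_iff_ne_zero.mp hn]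

/-- A family whose members are divisible by powers of `X` with exponents tending to infinity is
summable. -/
theorem summable_of_X_pow_dvd {ι : Type*} {f : ι → ℤ⟦X⟧} (w : ι → ℕ)
    (hw : ∀ d, {i | w i ≤ d}.Finite) (h : ∀ i, X ^ w i ∣ f i) : Summable f := by
  rw [PowerSeries.WithPiTopology.summable_iff_summable_coeff]
  intro d
  refine summable_of_hasFiniteSupport ((hw d).subset fun i hi => ?_)
  by_contra hlt
  exact hi (PowerSeries.X_pow_dvd_iff.mp (h i) d (not_le.mp hlt))

theorem finite_setOf_sum_le (j d : ℕ) : {a : Fin j → ℕ | ∑ i, a i ≤ d}.Finite :=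
  (Set.finite_Iic fun _ : Fin j => d).subset fun _ ha i =>
    (Finset.single_le_sum (fun _ _ => Nat.zero_le _) (Finset.mem_univ i)).trans ha

/-- A finite product of convergent series can be expanded. -/
theorem hasSum_prod_pi : ∀ {j : ℕ} {f : Fin j → ℕ → ℤ⟦X⟧} {s : Fin j → ℤ⟦X⟧},
    (∀ i a, X ^ a ∣ f i a) → (∀ i, HasSum (f i) (s i)) →
      HasSum (fun a : Fin j → ℕ => ∏ i, f i (a i)) (∏ i, s i)
  | 0, f, s, _, _ => by
    simp
  | j + 1, f, s, hd, hs => by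
    have ih := hasSum_prod_pi (fun i : Fin j => hd i.succ) (fun i => hs i.succ)
    rw [← (Fin.consEquiv fun _ : Fin (j + 1) => ℕ).hasSum_iff, Fin.prod_univ_succ]
    have hsum : Summable (fun p : ℕ × (Fin j → ℕ) => f 0 p.1 * ∏ i : Fin j, f i.succ (p.2 i)) := by
      refine summable_of_X_pow_dvd (fun p => p.1 + ∑ i, p.2 i) (fun d => ?_) fun p => ?_
      · refine ((Set.finite_Iic d).prod (finite_setOf_sum_le j d)).subset fun p hp => ?_
        have : p.1 + ∑ i, p.2 i ≤ d := hp
        refine ⟨?_, ?_⟩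
        · simp only [Set.mem_Iic]; omega
        · simp only [Set.mem_ofPred_eq]; omega
      · rw [pow_add, ← Finset.prod_pow_eq_pow_sum]
        exact mul_dvd_mul (hd 0 p.1) (Finset.prod_dvd_prod_of_dvd _ _ fun i _ => hd i.succ (p.2 i))
    refine ((hs 0).mul ih hsum).congr_fun ?_
    intro p
    simp [Fin.prod_univ_succ, Fin.consEquiv]

theorem hasSum_geometric {y : ℤ⟦X⟧} (hy : constantCoeff y = 0) :
    HasSum (fun a : ℕ => y ^ a) (Ring.inverse (1 - y)) := by
  rw [ringInverse_eq_of_mul_eq_one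
    (WithPiTopology.one_sub_mul_tsum_pow_of_constantCoeff_eq_zero hy)]
  exact (WithPiTopology.summable_pow_of_constantCoeff_eq_zero hy).hasSum

theorem hasSum_succ_mul_geometric {y : ℤ⟦X⟧} (hy : constantCoeff y = 0) :
    HasSum (fun a : ℕ => ((a + 1 : ℕ) : ℤ⟦X⟧) * y ^ (a + 1)) (y * Ring.inverse ((1 - y) ^ 2)) := by
  have hdvd : (X : ℤ⟦X⟧) ∣ y := PowerSeries.X_dvd_iff.mpr hy
  have hsum : Summable fun a : ℕ => (a : ℤ⟦X⟧) * y ^ a :=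
    summable_of_X_pow_dvd (fun a => a) (fun d => Set.finite_Iic d) fun a =>
      Dvd.dvd.mul_left (pow_dvd_pow_of_dvd hdvd a) _
  obtain ⟨T, hT⟩ := hsum
  have hshift : HasSum (fun a : ℕ => ((a + 1 : ℕ) : ℤ⟦X⟧) * y ^ (a + 1)) T := by
    have := (hasSum_nat_add_iff' (f := fun a : ℕ => (a : ℤ⟦X⟧) * y ^ a) 1).mpr hT
    simpa using this
  -- Multiplying by `1 - y` collapses the coefficients `a + 1` to `1`, leaving a geometric series
  -- that determines `T`.
  have hdiff : HasSum (fun a : ℕ => y * y ^ a) (T - y * T) :=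
    (hshift.sub (hT.mul_left y)).congr_fun fun a => by push_cast; ring
  have hgeo := (hasSum_geometric hy).mul_left y
  have heq := hdiff.unique hgeo
  have hu : IsUnit (1 - y) := by
    rw [PowerSeries.isUnit_iff_constantCoeff]; simp [hy]
  have hinv := Ring.mul_inverse_cancel _ hu
  have : y * Ring.inverse ((1 - y) ^ 2) = T := by
    rw [ringInverse_eq_of_mul_eq_one (b := Ring.inverse (1 - y) ^ 2)
      (by rw [← mul_pow, hinv, one_pow])]
    linear_combination (-Ring.inverse (1 - y)) * heq + T * hinv
  rw [this]
  exact hshift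

/-! ### Tuples and their successive differences -/

theorem eq_add_partialSum {j : ℕ} {g : Fin (j + 1) → ℕ} {d : Fin j → ℕ}
    (h : ∀ i : Fin j, g i.succ = g i.castSucc + d i) (i : Fin (j + 1)) :
    g i = g 0 + Fin.partialSum d i := by
  induction i using Fin.induction with
  | zero => simp
  | succ i ih => rw [h, ih, Fin.partialSum_succ, add_assoc]

theorem partialSum_injective {j : ℕ} {d e : Fin j → ℕ}
    (h : ∀ i : Fin j, Fin.partialSum d i.succ = Fin.partialSum e i.succ) : d = e := by
  have h' : ∀ i : Fin (j + 1), Fin.partialSum d i = Fin.partialSum e i := by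
    intro i
    cases i using Fin.cases with
    | zero => simp
    | succ i => exact h i
  funext i
  have := h i
  rw [Fin.partialSum_succ, Fin.partialSum_succ, h' i.castSucc] at this
  omega

theorem partialSum_eq_sum_ite {j : ℕ} (d : Fin j → ℕ) (i : Fin (j + 1)) :
    Fin.partialSum d i = ∑ l : Fin j, if l.castSucc < i then d l else 0 := by
  have := eq_add_partialSum (g := fun i => ∑ l : Fin j, if l.castSucc < i then d l else 0)
    (d := d) (fun i => ?_) i
  · simpa using this.symm
  · have : ∀ l : Fin j, (if l.castSucc < i.succ then d l else 0) =
        (if l.castSucc < i.castSucc then d l else 0) + if l = i then d l else 0 := by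
      intro l
      rcases lt_trichotomy l i with hl | hl | hl
      · simp [hl, hl.ne, hl.le]
      · simp [hl]
      · simp [hl.not_ge, hl.ne', hl.not_gt]
    simp only [this, Finset.sum_add_distrib, Finset.sum_ite_eq',
      Finset.mem_univ, if_true]

theorem partialSum_mono {j : ℕ} (d : Fin j → ℕ) : Monotone (Fin.partialSum d) :=
  Fin.monotone_iff_le_succ.mpr fun i => by rw [Fin.partialSum_succ]; omega

/-- The weakly increasing tuple with prescribed successive differences. -/
def weakOfDiff {j : ℕ} (d : Fin j → ℕ) : WeakTuple j :=
  ⟨fun i => 1 + Fin.partialSum d i.succ,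
    fun _ _ h => Nat.add_le_add_left (partialSum_mono d (Fin.succ_le_succ_iff.mpr h)) 1,
    fun _ => Nat.le_add_right _ _⟩

/-- The strictly increasing tuple whose successive differences are `b i + 1`. -/
def strictOfDiff {j : ℕ} (b : Fin j → ℕ) : StrictTuple j :=
  ⟨fun i => Fin.partialSum (fun i => b i + 1) i.succ,
    fun _ _ h => (Fin.strictMono_iff_lt_succ (f := Fin.partialSum fun i => b i + 1)).mpr
      (fun i => by rw [Fin.partialSum_succ]; omega) (Fin.succ_lt_succ_iff.mpr h),
    fun i => by simp only [Fin.partialSum_succ]; omega⟩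

theorem bijective_weakOfDiff (j : ℕ) : Function.Bijective (weakOfDiff (j := j)) := by
  refine ⟨fun d e h => partialSum_injective fun i => ?_, fun n => ?_⟩
  · have := congrFun (congrArg Subtype.val h) i
    simpa [weakOfDiff] using this
  -- Prepending `1`, the least allowed entry, makes the first difference `n_1 - 1`, which may be
  -- zero.
  · let g : Fin (j + 1) → ℕ := Fin.cons 1 n.1
    have hg : Monotone g := by
      refine Fin.monotone_iff_le_succ.mpr fun i => ?_
      cases j with
      | zero => exact i.elim0
      | succ j =>
        cases i using Fin.cases with
        | zero => simpa [g] using n.2.2 0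
        | succ i =>
          have : n.1 i.castSucc ≤ n.1 i.succ := n.2.1 i.castSucc_le_succ
          simpa [g, ← Fin.succ_castSucc] using this
    refine ⟨fun i => g i.succ - g i.castSucc, Subtype.ext (funext fun i => ?_)⟩
    have := eq_add_partialSum (g := g) (d := fun i => g i.succ - g i.castSucc)
      (fun i => (Nat.add_sub_cancel' (hg i.castSucc_le_succ)).symm) i.succ
    simpa [weakOfDiff, g] using this.symm

theorem bijective_strictOfDiff (j : ℕ) : Function.Bijective (strictOfDiff (j := j)) := by
  refine ⟨fun b c h => ?_, fun m => ?_⟩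
  · have : (fun i => b i + 1) = fun i => c i + 1 :=
      partialSum_injective fun i => congrFun (congrArg Subtype.val h) i
    funext i
    simpa using congrFun this i
  · have hg : StrictMono (consZero m.1) := by
      refine Fin.strictMono_iff_lt_succ.mpr fun i => ?_
      cases j with
      | zero => exact i.elim0
      | succ j =>
        cases i using Fin.cases with
        | zero => exact m.2.2 0
        | succ i =>
          have : m.1 i.castSucc < m.1 i.succ := m.2.1 i.castSucc_lt_succ
          simpa [consZero, ← Fin.succ_castSucc] using this
    refine ⟨fun i => consZero m.1 i.succ - consZero m.1 i.castSucc - 1,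
      Subtype.ext (funext fun i => ?_)⟩
    have := eq_add_partialSum (g := consZero m.1)
      (d := fun i => consZero m.1 i.succ - consZero m.1 i.castSucc - 1 + 1)
      (fun i => by have := hg i.castSucc_lt_succ; omega) i.succ
    simpa [strictOfDiff, consZero] using this.symm

theorem consZero_strictOfDiff {j : ℕ} (b : Fin j → ℕ) :
    consZero (strictOfDiff b).1 = Fin.partialSum fun i => b i + 1 := by
  funext i
  cases i using Fin.cases with
  | zero => simp [consZero]
  | succ i => simp [consZero, strictOfDiff]

theorem partialSum_last {j : ℕ} (d : Fin j → ℕ) : Fin.partialSum d (Fin.last j) = ∑ i, d i := by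
  rw [partialSum_eq_sum_ite]
  exact Finset.sum_congr rfl fun i _ => if_pos (Fin.castSucc_lt_last i)

/-- Summation by parts for the exponents of the double sum. -/
theorem sum_mul_weakOfDiff {j : ℕ} (b d : Fin j → ℕ) :
    ∑ i, (b i + 1) * (weakOfDiff d).1 i.rev =
      Fin.partialSum (fun i => b i + 1) (Fin.last j) +
        ∑ l, d l * (strictOfDiff b).1 l.rev := by
  rw [partialSum_last]
  simp only [weakOfDiff, strictOfDiff, mul_add, mul_one, Finset.sum_add_distrib,
    partialSum_eq_sum_ite, Finset.mul_sum]
  congr 1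
  rw [Finset.sum_comm]
  refine Finset.sum_congr rfl fun l _ => Finset.sum_congr rfl fun i _ => ?_
  -- With zero-based indices both sides say `i + l < j`; this symmetry, due to the reversal, lets
  -- `b` and `d` exchange roles.
  have : l.castSucc < i.rev.succ ↔ i.castSucc < l.rev.succ := by
    simp only [Fin.lt_def, Fin.val_castSucc, Fin.val_succ, Fin.val_rev]
    omega
  simp only [this, mul_ite, mul_zero, mul_comm]
  split_ifs <;> ring

/-! ### The double sum -/

/-- The summand `-q^n / (1 + q^n)^2`. -/
noncomputable def weakFactor (n : ℕ) : ℤ⟦X⟧ :=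
  -X ^ n * Ring.inverse ((1 + X ^ n) ^ 2)

theorem weakTerm_eq_prod {j : ℕ} {n : Fin j → ℕ} (hn : ∀ i, 1 ≤ n i) :
    weakTerm n = ∏ i, weakFactor (n i) := by
  have hinv : Ring.inverse (∏ i, (1 + X ^ n i : ℤ⟦X⟧) ^ 2) =
      ∏ i, Ring.inverse ((1 + X ^ n i : ℤ⟦X⟧) ^ 2) := by
    refine ringInverse_eq_of_mul_eq_one ?_
    rw [← Finset.prod_mul_distrib]
    exact Finset.prod_eq_one fun i _ =>
      Ring.mul_inverse_cancel _ ((isUnit_one_add_X_pow (hn i)).pow 2)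
  simp only [weakTerm, weakFactor, Finset.prod_mul_distrib, hinv, Finset.prod_neg,
    Finset.card_univ, Fintype.card_fin, Finset.prod_pow_eq_pow_sum]

/-- The common refinement of the two multiple sums. -/
noncomputable def doubleTerm {j : ℕ} (b d : Fin j → ℕ) : ℤ⟦X⟧ :=
  ∏ i, ((b i + 1 : ℕ) : ℤ⟦X⟧) * (-X ^ (weakOfDiff d).1 i.rev) ^ (b i + 1)

theorem hasSum_doubleTerm_left {j : ℕ} (d : Fin j → ℕ) :
    HasSum (fun b => doubleTerm b d) (weakTerm (weakOfDiff d).1) := by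
  have hpos := (weakOfDiff d).2.2
  rw [weakTerm_eq_prod hpos, ← Equiv.prod_comp Fin.revPerm]
  refine hasSum_prod_pi (f := fun i a => ((a + 1 : ℕ) : ℤ⟦X⟧) *
    (-X ^ (weakOfDiff d).1 i.rev) ^ (a + 1)) (fun i a => Dvd.dvd.mul_left ?_ _) fun i => ?_
  · refine (pow_dvd_pow _ (Nat.le_succ a)).trans (pow_dvd_pow_of_dvd ?_ _)
    exact (dvd_neg.mpr (dvd_pow_self _ (Nat.one_le_iff_ne_zero.mp (hpos _))))
  · have := hasSum_succ_mul_geometric (y := -X ^ (weakOfDiff d).1 i.rev)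
      (by simp [Nat.one_le_iff_ne_zero.mp (hpos _)])
    simpa [weakFactor] using this

/-- Summation by parts isolates the dependence on `d` in a product of powers, ready for geometric
summation. -/
theorem doubleTerm_eq {j : ℕ} (b d : Fin j → ℕ) :
    doubleTerm b d = ((-1) ^ consZero (strictOfDiff b).1 (Fin.last j) *
      (∏ i, ((b i + 1 : ℕ) : ℤ⟦X⟧)) * X ^ consZero (strictOfDiff b).1 (Fin.last j)) *
        ∏ l, (X ^ (strictOfDiff b).1 l.rev) ^ d l := by
  have h2 : ∀ i, (-X ^ (weakOfDiff d).1 i.rev : ℤ⟦X⟧) ^ (b i + 1) =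
      (-1) ^ (b i + 1) * X ^ ((b i + 1) * (weakOfDiff d).1 i.rev) := by
    intro i
    rw [neg_pow, ← pow_mul, mul_comm (b i + 1)]
  simp only [doubleTerm, h2, Finset.prod_mul_distrib, Finset.prod_pow_eq_pow_sum, ← pow_mul,
    sum_mul_weakOfDiff, consZero_strictOfDiff, partialSum_last, pow_add (X : ℤ⟦X⟧),
    mul_comm (d _)]
  ring

theorem hasSum_doubleTerm_right {j : ℕ} (b : Fin j → ℕ) :
    HasSum (fun d => doubleTerm b d) (strictTerm (strictOfDiff b).1) := by
  have hpos := (strictOfDiff b).2.2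
  have hgeo := fun l : Fin j => hasSum_geometric (y := X ^ (strictOfDiff b).1 l.rev)
    (by simp [Nat.one_le_iff_ne_zero.mp (hpos _)])
  have hprod := hasSum_prod_pi (fun l a => pow_dvd_pow_of_dvd
    (dvd_pow_self (X : ℤ⟦X⟧) (Nat.one_le_iff_ne_zero.mp (hpos l.rev))) a) hgeo
  have hinv : Ring.inverse (∏ i, (1 - X ^ (strictOfDiff b).1 i : ℤ⟦X⟧)) =
      ∏ l : Fin j, Ring.inverse (1 - X ^ (strictOfDiff b).1 l.rev : ℤ⟦X⟧) := by
    refine ringInverse_eq_of_mul_eq_one ?_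
    rw [← Equiv.prod_comp Fin.revPerm, ← Finset.prod_mul_distrib]
    refine Finset.prod_eq_one fun i _ => Ring.mul_inverse_cancel _ ?_
    rw [PowerSeries.isUnit_iff_constantCoeff]
    simp [Nat.one_le_iff_ne_zero.mp (hpos _)]
  have hdiff : ∀ i : Fin j, ((consZero (strictOfDiff b).1 i.succ : ℤ⟦X⟧) -
      (consZero (strictOfDiff b).1 i.castSucc : ℤ⟦X⟧)) = ((b i + 1 : ℕ) : ℤ⟦X⟧) := by
    intro i
    rw [consZero_strictOfDiff, Fin.partialSum_succ]
    push_cast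
    ring
  simp only [strictTerm, hdiff, hinv, doubleTerm_eq]
  exact hprod.mul_left _

/-- Joint summability is what permits interchanging the sums over `b` and `d`: the order of a term
is at least `∑ b + ∑ d`. -/
theorem summable_doubleTerm (j : ℕ) :
    Summable fun p : (Fin j → ℕ) × (Fin j → ℕ) => doubleTerm p.1 p.2 := by
  refine summable_of_X_pow_dvd (fun p => ∑ i, p.1 i + ∑ i, p.2 i) (fun N => ?_) fun p => ?_
  · refine ((finite_setOf_sum_le j N).prod (finite_setOf_sum_le j N)).subset fun p hp => ?_
    have : ∑ i, p.1 i + ∑ i, p.2 i ≤ N := hp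
    constructor <;> simp only [Set.mem_ofPred_eq] <;> omega
  · rw [doubleTerm_eq, pow_add]
    refine mul_dvd_mul (Dvd.dvd.mul_left (pow_dvd_pow _ ?_) _) ?_
    · rw [consZero_strictOfDiff, partialSum_last]
      exact Finset.sum_le_sum fun i _ => Nat.le_succ _
    · rw [← Finset.prod_pow_eq_pow_sum]
      exact Finset.prod_dvd_prod_of_dvd _ _ fun l _ => pow_dvd_pow_of_dvd
        (dvd_pow_self _ (Nat.one_le_iff_ne_zero.mp ((strictOfDiff p.1).2.2 _))) _

/-- Both multiple sums converge, and they have the same value. -/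
theorem exists_hasSum_weakTerm_and_strictTerm (j : ℕ) :
    ∃ S : ℤ⟦X⟧, HasSum (fun n : WeakTuple j => weakTerm n.1) S ∧
      HasSum (fun m : StrictTuple j => strictTerm m.1) S := by
  obtain ⟨S, hS⟩ := summable_doubleTerm j
  refine ⟨S, ?_, ?_⟩
  · rw [← (Equiv.ofBijective _ (bijective_weakOfDiff j)).hasSum_iff]
    exact ((Equiv.prodComm _ _).hasSum_iff.mpr hS).prod_fiberwise hasSum_doubleTerm_left
  · rw [← (Equiv.ofBijective _ (bijective_strictOfDiff j)).hasSum_iff]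
    exact hS.prod_fiberwise hasSum_doubleTerm_right

/-! ### Truncations of the sum over weakly increasing tuples -/

open Classical in
/-- The weakly increasing tuples with entries between `1` and `N`. -/
noncomputable def weakFinset (j N : ℕ) : Finset (Fin j → ℕ) :=
  (Fintype.piFinset fun _ => Finset.Icc 1 N).filter Monotone

theorem mem_weakFinset {j N : ℕ} {n : Fin j → ℕ} :
    n ∈ weakFinset j N ↔ (∀ i, 1 ≤ n i ∧ n i ≤ N) ∧ Monotone n := by
  simp [weakFinset]

/-- The complete homogeneous sum of degree `j` in `weakFactor 1, …, weakFactor N`. -/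
noncomputable def weakSum (j N : ℕ) : ℤ⟦X⟧ :=
  ∑ n ∈ weakFinset j N, ∏ i, weakFactor (n i)

theorem weakSum_zero_left (N : ℕ) : weakSum 0 N = 1 := by
  have : weakFinset 0 N = Finset.univ := Finset.eq_univ_iff_forall.mpr fun n =>
    mem_weakFinset.mpr ⟨fun i => i.elim0, Subsingleton.monotone n⟩
  simp [weakSum, this]

theorem weakSum_succ_zero (j : ℕ) : weakSum (j + 1) 0 = 0 := by
  have : weakFinset (j + 1) 0 = ∅ := by
    refine Finset.eq_empty_of_forall_notMem fun n hn => ?_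
    have := (mem_weakFinset.mp hn).1 0
    omega
  simp [weakSum, this]

/-- Split by whether the largest entry is at most `N`; otherwise it equals `N + 1` and can be
removed. -/
theorem weakSum_succ_succ (j N : ℕ) :
    weakSum (j + 1) (N + 1) = weakSum (j + 1) N + weakFactor (N + 1) * weakSum j (N + 1) := by
  classical
  unfold weakSum
  rw [← Finset.sum_filter_add_sum_filter_not (weakFinset (j + 1) (N + 1))
    (fun n => n (Fin.last j) ≤ N), Finset.mul_sum]
  congr 1
  · refine Finset.sum_congr ?_ fun _ _ => rfl
    ext n
    simp only [Finset.mem_filter, mem_weakFinset]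
    constructor
    · rintro ⟨⟨h, hm⟩, hl⟩
      exact ⟨fun i => ⟨(h i).1, (hm (Fin.le_last i)).trans hl⟩, hm⟩
    · rintro ⟨h, hm⟩
      exact ⟨⟨fun i => ⟨(h i).1, (h i).2.trans (Nat.le_succ N)⟩, hm⟩, (h _).2⟩
  · refine Finset.sum_bij' (fun n _ => Fin.init n) (fun n _ => Fin.snoc n (N + 1)) ?_ ?_ ?_ ?_ ?_
    · intro n hn
      simp only [Finset.mem_filter, mem_weakFinset] at hn ⊢
      exact ⟨fun i => hn.1.1 i.castSucc, fun a b hab => hn.1.2 (by simpa using hab)⟩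
    · intro n hn
      simp only [Finset.mem_filter, mem_weakFinset] at hn ⊢
      refine ⟨⟨fun i => ?_, fun a b hab => ?_⟩, by simp⟩
      · cases i using Fin.lastCases with
        | last => simp
        | cast i => simpa using hn.1 i
      · cases b using Fin.lastCases with
        | last =>
          cases a using Fin.lastCases with
          | last => exact le_rfl
          | cast a => simpa using (hn.1 a).2
        | cast b =>
          cases a using Fin.lastCases with
          | last => exact absurd hab (not_le.mpr (Fin.castSucc_lt_last b))
          | cast a => simpa using hn.2 (by simpa using hab)
    · intro n hn
      simp only [Finset.mem_filter, mem_weakFinset] at hn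
      have : n (Fin.last j) = N + 1 := by
        have := (hn.1.1 (Fin.last j)).2
        omega
      rw [← this, Fin.snoc_init_self]
    · intro n _
      simp
    · intro n hn
      simp only [Finset.mem_filter, mem_weakFinset] at hn
      have : n (Fin.last j) = N + 1 := by
        have := (hn.1.1 (Fin.last j)).2
        omega
      rw [Fin.prod_univ_castSucc, this, mul_comm]
      rfl

theorem tendsto_weakSum {j : ℕ} {S : ℤ⟦X⟧}
    (hS : HasSum (fun n : WeakTuple j => weakTerm n.1) S) :
    Filter.Tendsto (weakSum j) Filter.atTop (nhds S) := by
  classical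
  let F : ℕ → Finset (WeakTuple j) := fun N => (weakFinset j N).subtype _
  have hF : Filter.Tendsto F Filter.atTop Filter.atTop := by
    refine Filter.tendsto_atTop_finset_of_monotone (fun M N hMN n hn => ?_) fun n => ?_
    · simp only [F, Finset.mem_subtype, mem_weakFinset] at hn ⊢
      exact ⟨fun i => ⟨(hn.1 i).1, (hn.1 i).2.trans hMN⟩, hn.2⟩
    · refine ⟨∑ i, n.1 i, ?_⟩
      simp only [F, Finset.mem_subtype, mem_weakFinset]
      exact ⟨fun i => ⟨n.2.2 i, Finset.single_le_sum (fun _ _ => Nat.zero_le _)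
        (Finset.mem_univ i)⟩, n.2.1⟩
  refine (hS.comp hF).congr fun N => ?_
  have : ∀ n ∈ weakFinset j N, Monotone n ∧ ∀ i, 1 ≤ n i := fun n hn =>
    ⟨(mem_weakFinset.mp hn).2, fun i => ((mem_weakFinset.mp hn).1 i).1⟩
  rw [weakSum, ← Finset.sum_subtype_of_mem _ this]
  exact Finset.sum_congr rfl fun n _ => weakTerm_eq_prod n.2.2

/-! ### The crank generating function over Laurent polynomials -/

open LaurentPolynomial

/-- The weight `(-1)^m binom(m + j - 1, 2j)`. -/
noncomputable def crankWeight (j : ℕ) (m : ℤ) : ℤ :=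
  Ring.choose (m + (j : ℤ) - 1) (2 * j) * (m.negOnePow : ℤ)

theorem crankWeight_zero_left (m : ℤ) : crankWeight 0 m = m.negOnePow := by
  simp [crankWeight]

theorem crankWeight_succ_zero (j : ℕ) : crankWeight (j + 1) 0 = 0 := by
  have h : (0 : ℤ) + ((j + 1 : ℕ) : ℤ) - 1 = (j : ℕ) := by push_cast; ring
  rw [crankWeight, h, Ring.choose_natCast, Nat.choose_eq_zero_of_lt (by omega)]
  simp

/-- Up to sign this is the second difference `binom(x+2, r+2) - 2 binom(x+1, r+2) + binom(x, r+2) =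
binom(x, r)` with `x = m + j - 1`, `r = 2j`; the parity sign turns the middle minus into a plus. -/
theorem crankWeight_add_one_add_sub_one (j : ℕ) (m : ℤ) :
    crankWeight (j + 1) (1 + m) + crankWeight (j + 1) (-1 + m) =
      -(2 * crankWeight (j + 1) m + crankWeight j m) := by
  have h1 : (1 + m) + ((j + 1 : ℕ) : ℤ) - 1 = (m + j - 1) + 1 + 1 := by push_cast; ring
  have h2 : m + ((j + 1 : ℕ) : ℤ) - 1 = (m + j - 1) + 1 := by push_cast; ring
  have h3 : (-1 + m) + ((j + 1 : ℕ) : ℤ) - 1 = m + j - 1 := by push_cast; ring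
  have h4 : 2 * (j + 1) = 2 * j + 1 + 1 := by ring
  simp only [crankWeight, h1, h2, h3, h4, Ring.choose_succ_succ, Int.negOnePow_add,
    Int.negOnePow_neg, Int.negOnePow_one, Units.val_mul, Units.val_neg, Units.val_one]
  ring

theorem crankWeight_zero_add_one_add_sub_one (m : ℤ) :
    crankWeight 0 (1 + m) + crankWeight 0 (-1 + m) = -(2 * crankWeight 0 m) := by
  simp only [crankWeight_zero_left, Int.negOnePow_add,
    Int.negOnePow_neg, Int.negOnePow_one, Units.val_mul, Units.val_neg, Units.val_one]
  ring

/-- The functional on Laurent polynomials that sends `z^m` to `crankWeight j m`. -/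
noncomputable def crankFunctional (j : ℕ) : ℤ[T;T⁻¹] →ₗ[ℤ] ℤ :=
  (Finsupp.linearCombination ℤ (crankWeight j)).comp
    (AddMonoidAlgebra.coeffLinearEquiv ℤ).toLinearMap

theorem crankFunctional_T (j : ℕ) (m : ℤ) : crankFunctional j (T m) = crankWeight j m := by
  change Finsupp.linearCombination ℤ (crankWeight j) (Finsupp.single m 1) = _
  simp

theorem linearMap_ext_T {φ ψ : ℤ[T;T⁻¹] →ₗ[ℤ] ℤ} (h : ∀ m, φ (T m) = ψ (T m)) : φ = ψ := by
  refine LinearMap.ext fun f => ?_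
  induction f using LaurentPolynomial.induction_on' with
  | add p q hp hq => rw [map_add, map_add, hp, hq]
  | C_mul_T n a => rw [← LaurentPolynomial.smul_eq_C_mul, map_smul, map_smul, h]

theorem crankFunctional_succ_mul (j : ℕ) (f : ℤ[T;T⁻¹]) :
    crankFunctional (j + 1) ((T 1 + T (-1)) * f) =
      -(2 * crankFunctional (j + 1) f + crankFunctional j f) := by
  have : (crankFunctional (j + 1)).comp (LinearMap.mulLeft ℤ (T 1 + T (-1))) =
      -((2 : ℤ) • crankFunctional (j + 1) + crankFunctional j) := by
    refine linearMap_ext_T fun m => ?_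
    rw [LinearMap.comp_apply, LinearMap.mulLeft_apply, add_mul, ← T_add, ← T_add, map_add]
    simpa [crankFunctional_T] using crankWeight_add_one_add_sub_one j m
  simpa using LinearMap.congr_fun this f

theorem crankFunctional_zero_mul (f : ℤ[T;T⁻¹]) :
    crankFunctional 0 ((T 1 + T (-1)) * f) = -(2 * crankFunctional 0 f) := by
  have : (crankFunctional 0).comp (LinearMap.mulLeft ℤ (T 1 + T (-1))) =
      -((2 : ℤ) • crankFunctional 0) := by
    refine linearMap_ext_T fun m => ?_
    rw [LinearMap.comp_apply, LinearMap.mulLeft_apply, add_mul, ← T_add, ← T_add, map_add]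
    simpa [crankFunctional_T] using crankWeight_zero_add_one_add_sub_one m
  simpa using LinearMap.congr_fun this f

/-- `crankFunctional j` applied to every coefficient. -/
noncomputable def crankMap (j : ℕ) (f : ℤ[T;T⁻¹]⟦X⟧) : ℤ⟦X⟧ :=
  PowerSeries.mk fun n => crankFunctional j (coeff n f)

theorem crankMap_add (j : ℕ) (f g : ℤ[T;T⁻¹]⟦X⟧) :
    crankMap j (f + g) = crankMap j f + crankMap j g := by
  ext n
  simp [crankMap]

theorem crankMap_neg (j : ℕ) (f : ℤ[T;T⁻¹]⟦X⟧) : crankMap j (-f) = -crankMap j f := by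
  ext n
  simp [crankMap]

theorem crankMap_map_mul (j : ℕ) (g : ℤ⟦X⟧) (f : ℤ[T;T⁻¹]⟦X⟧) :
    crankMap j (PowerSeries.map (Int.castRingHom _) g * f) = g * crankMap j f := by
  ext n
  simp only [crankMap, coeff_mk, coeff_mul, map_sum, coeff_map, eq_intCast]
  refine Finset.sum_congr rfl fun p _ => ?_
  rw [← zsmul_eq_mul, map_zsmul, smul_eq_mul]

theorem crankMap_C_mul_succ (j : ℕ) (f : ℤ[T;T⁻¹]⟦X⟧) :
    crankMap (j + 1) (PowerSeries.C (T 1 + T (-1)) * f) =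
      -(2 * crankMap (j + 1) f + crankMap j f) := by
  ext n
  have h2 : (2 : ℤ⟦X⟧) = PowerSeries.C 2 := rfl
  rw [crankMap, coeff_mk, coeff_C_mul, crankFunctional_succ_mul, map_neg, map_add, h2,
    coeff_C_mul, crankMap, crankMap, coeff_mk, coeff_mk]

theorem crankMap_C_mul_zero (f : ℤ[T;T⁻¹]⟦X⟧) :
    crankMap 0 (PowerSeries.C (T 1 + T (-1)) * f) = -(2 * crankMap 0 f) := by
  ext n
  have h2 : (2 : ℤ⟦X⟧) = PowerSeries.C 2 := rfl
  simp only [crankMap, coeff_mk, coeff_C_mul, crankFunctional_zero_mul, map_neg, h2]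

/-- The Euler factor `(1 - z q^n) (1 - z⁻¹ q^n)`. -/
noncomputable def eulerFactor (n : ℕ) : ℤ[T;T⁻¹]⟦X⟧ :=
  (1 - PowerSeries.C (T 1) * X ^ n) * (1 - PowerSeries.C (T (-1)) * X ^ n)

theorem eulerFactor_mul (n : ℕ) (f : ℤ[T;T⁻¹]⟦X⟧) :
    eulerFactor n * f = PowerSeries.map (Int.castRingHom _) (1 + X ^ n * X ^ n) * f +
      -(PowerSeries.map (Int.castRingHom _) (X ^ n) * (PowerSeries.C (T 1 + T (-1)) * f)) := by
  have h : PowerSeries.C (T 1 : ℤ[T;T⁻¹]) * PowerSeries.C (T (-1)) = 1 := by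
    rw [← map_mul, ← T_add]
    simp
  simp only [eulerFactor, map_add, map_mul, map_one, map_pow, PowerSeries.map_X]
  linear_combination (X ^ n * X ^ n * f) * h

/-- The factor is `1 + q^{2n} - (z + z⁻¹) q^n`, and `z + z⁻¹` acts as `-2` plus a drop in `j`, which
completes the square. -/
theorem crankMap_succ_eulerFactor_mul (j n : ℕ) (f : ℤ[T;T⁻¹]⟦X⟧) :
    crankMap (j + 1) (eulerFactor n * f) =
      (1 + X ^ n) ^ 2 * crankMap (j + 1) f + X ^ n * crankMap j f := by
  rw [eulerFactor_mul, crankMap_add, crankMap_neg, crankMap_map_mul, crankMap_map_mul,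
    crankMap_C_mul_succ]
  ring

theorem crankMap_zero_eulerFactor_mul (n : ℕ) (f : ℤ[T;T⁻¹]⟦X⟧) :
    crankMap 0 (eulerFactor n * f) = (1 + X ^ n) ^ 2 * crankMap 0 f := by
  rw [eulerFactor_mul, crankMap_add, crankMap_neg, crankMap_map_mul, crankMap_map_mul,
    crankMap_C_mul_zero]
  ring

theorem isUnit_one_sub_C_mul_X_pow {R : Type*} [CommRing R] (z : R) (n : ℕ) :
    IsUnit (1 - PowerSeries.C z * X ^ (n + 1)) := by
  rw [PowerSeries.isUnit_iff_constantCoeff]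
  simp

/-- The generating function of pairs of partitions with at most `N` as largest part, where `z`
marks the crank. -/
noncomputable def crankProd (N : ℕ) : ℤ[T;T⁻¹]⟦X⟧ :=
  ∏ i ∈ Finset.range N, (Ring.inverse (1 - PowerSeries.C (T 1) * X ^ (i + 1)) *
    Ring.inverse (1 - PowerSeries.C (T (-1)) * X ^ (i + 1)))

theorem eulerFactor_mul_crankProd (N : ℕ) :
    eulerFactor (N + 1) * crankProd (N + 1) = crankProd N := by
  have h1 := Ring.mul_inverse_cancel _ (isUnit_one_sub_C_mul_X_pow (T 1 : ℤ[T;T⁻¹]) N)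
  have h2 := Ring.mul_inverse_cancel _ (isUnit_one_sub_C_mul_X_pow (T (-1) : ℤ[T;T⁻¹]) N)
  rw [crankProd, Finset.prod_range_succ, ← crankProd, eulerFactor]
  calc _ = crankProd N * ((1 - PowerSeries.C (T 1) * X ^ (N + 1)) *
        Ring.inverse (1 - PowerSeries.C (T 1) * X ^ (N + 1))) *
        ((1 - PowerSeries.C (T (-1)) * X ^ (N + 1)) *
        Ring.inverse (1 - PowerSeries.C (T (-1)) * X ^ (N + 1))) := by ring
    _ = _ := by rw [h1, h2, mul_one, mul_one]

theorem crankMap_one (j : ℕ) : crankMap j 1 = PowerSeries.C (crankWeight j 0) := by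
  ext n
  rw [crankMap, coeff_mk, coeff_one, coeff_C]
  split_ifs
  · rw [← T_zero, crankFunctional_T]
  · simp

/-- The truncated moments are the truncated multiple sums. -/
theorem crankMap_crankProd : ∀ j N : ℕ,
    crankMap j (crankProd N) * ∏ i ∈ Finset.range N, (1 + X ^ (i + 1)) ^ 2 = weakSum j N
  | 0, 0 => by simp [crankProd, crankMap_one, crankWeight_zero_left, weakSum_zero_left]
  | j + 1, 0 => by simp [crankProd, crankMap_one, crankWeight_succ_zero, weakSum_succ_zero]
  | 0, N + 1 => by
    have ih := crankMap_crankProd 0 N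
    rw [weakSum_zero_left, ← eulerFactor_mul_crankProd N, crankMap_zero_eulerFactor_mul] at ih
    rw [weakSum_zero_left, Finset.prod_range_succ]
    linear_combination ih
  | j + 1, N + 1 => by
    have ih := crankMap_crankProd (j + 1) N
    have ih' := crankMap_crankProd j (N + 1)
    rw [weakSum_succ_succ, ← ih, ← ih', ← eulerFactor_mul_crankProd N,
      crankMap_succ_eulerFactor_mul, Finset.prod_range_succ, weakFactor]
    -- The drop term `q^{N+1}` cancels against `weakFactor (N + 1)` times `(1 + q^{N+1})^2`.
    have h := Ring.mul_inverse_cancel _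
      ((isUnit_one_add_X_pow (Nat.le_add_left 1 N)).pow 2)
    linear_combination (X ^ (N + 1) * crankMap j (crankProd (N + 1)) *
      ∏ i ∈ Finset.range N, (1 + X ^ (i + 1)) ^ 2) * h

/-! ### Partitions counted by their number of parts -/

/-- The generating function of partitions, where `z` marks the number of parts. -/
noncomputable def partsGenFun {R : Type*} [CommRing R] (z : R) : R⟦X⟧ :=
  Nat.Partition.genFun fun _ c => z ^ c

theorem coeff_partsGenFun {R : Type*} [CommRing R] (z : R) (n : ℕ) :
    coeff n (partsGenFun z) = ∑ p : n.Partition, z ^ p.parts.card := by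
  rw [partsGenFun, Nat.Partition.coeff_genFun]
  refine Finset.sum_congr rfl fun p _ => ?_
  rw [Finsupp.prod, Finset.prod_pow_eq_pow_sum]
  simp

theorem hasProd_partsGenFun {R : Type*} [CommRing R] [TopologicalSpace R] [IsTopologicalRing R]
    [T2Space R] (z : R) :
    HasProd (fun i : ℕ => Ring.inverse (1 - PowerSeries.C z * X ^ (i + 1))) (partsGenFun z) := by
  refine (Nat.Partition.hasProd_genFun fun _ c => z ^ c).congr_fun fun i => ?_
  have h0 : constantCoeff (PowerSeries.C z * X ^ (i + 1)) = 0 := by simp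
  rw [ringInverse_eq_of_mul_eq_one
    (WithPiTopology.one_sub_mul_tsum_pow_of_constantCoeff_eq_zero h0),
    (WithPiTopology.summable_pow_of_constantCoeff_eq_zero h0).tsum_eq_zero_add, pow_zero]
  congr 1
  refine tsum_congr fun a => ?_
  rw [mul_pow, ← map_pow, ← pow_mul, PowerSeries.smul_eq_C_mul]

theorem partsGenFun_one_mul_qPochInf : partsGenFun (1 : ℤ) * qPochInf X = 1 := by
  have h := (hasProd_partsGenFun (1 : ℤ)).mul (multipliable_qPochInf X).hasProd
  refine h.unique (hasProd_one.congr_fun fun i => ?_)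
  have hu := Ring.inverse_mul_cancel _ (isUnit_one_sub_C_mul_X_pow (1 : ℤ) i)
  rw [map_one, one_mul] at hu
  rw [map_one, one_mul, ← pow_succ', hu]

theorem map_partsGenFun_one {R : Type*} [CommRing R] :
    PowerSeries.map (Int.castRingHom R) (partsGenFun 1) = partsGenFun 1 := by
  ext n
  simp [coeff_partsGenFun]

theorem tendsto_crankMap_crankProd (j : ℕ) :
    Filter.Tendsto (fun N => crankMap j (crankProd N)) Filter.atTop
      (nhds (crankMap j (partsGenFun (T 1) * partsGenFun (T (-1))))) := by
  -- In the discrete topology every functional on the coefficients is continuous, so it passes to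
  -- the limit.
  let _ : TopologicalSpace ℤ[T;T⁻¹] := ⊥
  have : DiscreteTopology ℤ[T;T⁻¹] := ⟨rfl⟩
  have h : Filter.Tendsto crankProd Filter.atTop
      (nhds (partsGenFun (T 1) * partsGenFun (T (-1)))) :=
    ((hasProd_partsGenFun (T 1 : ℤ[T;T⁻¹])).mul
      (hasProd_partsGenFun (T (-1) : ℤ[T;T⁻¹]))).tendsto_prod_nat
  rw [WithPiTopology.tendsto_iff_coeff_tendsto] at h ⊢
  intro d
  simp only [crankMap, coeff_mk]
  exact (continuous_of_discreteTopology.tendsto _).comp (h d)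

theorem tendsto_prod_one_add_X_pow_sq :
    Filter.Tendsto (fun N => ∏ i ∈ Finset.range N, (1 + X ^ (i + 1) : ℤ⟦X⟧) ^ 2) Filter.atTop
      (nhds (qPochInf (-X) ^ 2)) := by
  refine ((multipliable_qPochInf (-X)).hasProd.tendsto_prod_nat.pow 2).congr fun N => ?_
  rw [← Finset.prod_pow]
  refine Finset.prod_congr rfl fun i _ => ?_
  rw [pow_succ' X i]
  ring

theorem crankMap_mul_qPochInf_sq {j : ℕ} {S : ℤ⟦X⟧}
    (hS : HasSum (fun n : WeakTuple j => weakTerm n.1) S) :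
    crankMap j (partsGenFun (T 1) * partsGenFun (T (-1))) * qPochInf (-X) ^ 2 = S := by
  refine tendsto_nhds_unique ?_ (tendsto_weakSum hS)
  refine ((tendsto_crankMap_crankProd j).mul tendsto_prod_one_add_X_pow_sq).congr fun N => ?_
  exact crankMap_crankProd j N

/-! ### Colored partitions -/

theorem coeff_prod_partsGenFun {R : Type*} [CommRing R] {k : ℕ} (z : Fin k → R) (n : ℕ) :
    coeff n (∏ i, partsGenFun (z i)) =
      ∑ π : ColoredPartition k n, ∏ i, z i ^ (π.2 i).parts.card := by
  rw [coeff_prod, Fintype.sum_sigma]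
  simp only [coeff_partsGenFun]
  rw [← Finset.sum_coe_sort]
  refine Finset.sum_bij' (fun c _ => ⟨c.1, Finset.Nat.mem_antidiagonalTuple.mpr
      (Finset.mem_finsuppAntidiag.mp c.2).1⟩)
    (fun c _ => ⟨Finsupp.equivFunOnFinite.symm c.1,
      Finset.mem_finsuppAntidiag.mpr ⟨Finset.Nat.mem_antidiagonalTuple.mp c.2,
        Finset.subset_univ _⟩⟩)
    (fun _ _ => Finset.mem_univ _) (fun _ _ => Finset.mem_univ _)
    (fun c _ => by ext; simp) (fun c _ => by ext; simp) fun c _ => ?_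
  rw [Finset.prod_univ_sum, Fintype.piFinset_univ]

theorem card_parts_le {n : ℕ} (p : n.Partition) : p.parts.card ≤ n := by
  have h := Multiset.card_nsmul_le_sum (s := p.parts) (a := 1) fun _ hx => p.parts_pos hx
  rw [p.parts_sum] at h
  simpa using h

/-- Ensures that the range `-n ≤ m ≤ n` in the moment misses no colored partition. -/
theorem crank_mem_Icc {k : ℕ} (hk : 2 ≤ k) {n : ℕ} (π : ColoredPartition k n) :
    crank hk π ∈ Finset.Icc (-(n : ℤ)) n := by
  have h : ∀ i, (π.2 i).parts.card ≤ n := fun i => (card_parts_le _).trans <|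
    (Finset.single_le_sum (fun _ _ => Nat.zero_le _) (Finset.mem_univ i)).trans
      (Finset.Nat.mem_antidiagonalTuple.mp π.1.2).le
  have h0 := h ⟨0, by omega⟩
  have h1 := h ⟨1, by omega⟩
  rw [Finset.mem_Icc, crank]
  omega

theorem moment_eq_sum (j : ℕ) {k : ℕ} (hk : 2 ≤ k) (n : ℕ) :
    moment j hk n = ∑ π : ColoredPartition k n, crankWeight j (crank hk π) := by
  rw [moment, ← Finset.sum_fiberwise_of_maps_to (fun π _ => crank_mem_Icc hk π)]
  refine Finset.sum_congr rfl fun m _ => ?_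
  rw [Finset.sum_congr rfl fun π hπ => by rw [(Finset.mem_filter.mp hπ).2], Finset.sum_const,
    crankCount, Fintype.card_subtype, nsmul_eq_mul, mul_comm, crankWeight]

theorem mk_moment (j k : ℕ) (hk : 2 ≤ k + 2) :
    PowerSeries.mk (fun n => moment j hk n) =
      partsGenFun 1 ^ k * crankMap j (partsGenFun (T 1) * partsGenFun (T (-1))) := by
  rw [← crankMap_map_mul, map_pow, map_partsGenFun_one]
  ext n
  -- Only the first two colors enter the crank, with opposite signs; the remaining `k` get weight
  -- `1`.
  let z : Fin (k + 2) → ℤ[T;T⁻¹] := Fin.cons (T 1) (Fin.cons (T (-1)) fun _ => 1)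
  have hz : partsGenFun 1 ^ k * (partsGenFun (T 1) * partsGenFun (T (-1))) =
      ∏ i, partsGenFun (z i) := by
    simp only [z, Fin.prod_univ_succ, Fin.cons_zero, Fin.cons_succ, Finset.prod_const,
      Finset.card_univ, Fintype.card_fin]
    ring
  rw [hz, crankMap, coeff_mk, coeff_mk, coeff_prod_partsGenFun, map_sum, moment_eq_sum]
  refine Finset.sum_congr rfl fun π _ => ?_
  have : ∏ i, z i ^ (π.2 i).parts.card = T (crank hk π) := by
    simp only [z, Fin.prod_univ_succ, Fin.cons_zero, Fin.cons_succ, one_pow, Finset.prod_const_one,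
      mul_one, T_pow, ← T_add, crank]
    congr 1
    ring_nf
    rfl
  rw [this, crankFunctional_T]

theorem mk_moment_eq_prefactor_mul {j k : ℕ} (hk : 2 ≤ k) {S : ℤ⟦X⟧}
    (hS : HasSum (fun n : WeakTuple j => weakTerm n.1) S) :
    PowerSeries.mk (fun n => moment j hk n) = prefactor k * S := by
  obtain ⟨k, rfl⟩ := Nat.exists_eq_add_of_le' hk
  have hX : qPochInf X * partsGenFun (1 : ℤ) = 1 := by
    rw [mul_comm, partsGenFun_one_mul_qPochInf]
  have hpow : qPochInf X ^ k * partsGenFun (1 : ℤ) ^ k = 1 := by rw [← mul_pow, hX, one_pow]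
  have hcoeff : constantCoeff (qPochInf (-X)) = 1 := by
    have h := (multipliable_qPochInf (-X)).hasProd.map constantCoeff
      (WithPiTopology.continuous_constantCoeff ℤ)
    refine h.unique (hasProd_one.congr_fun fun i => ?_)
    simp
  have hunit : IsUnit (qPochInf (-X) ^ 2) := by
    rw [PowerSeries.isUnit_iff_constantCoeff]
    simp [hcoeff]
  have hinv := Ring.mul_inverse_cancel _ hunit
  have hpre : prefactor (k + 2) =
      partsGenFun (1 : ℤ) ^ k * Ring.inverse (qPochInf (-X) ^ 2) := by
    refine ringInverse_eq_of_mul_eq_one ?_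
    rw [Nat.add_sub_cancel]
    linear_combination (qPochInf (-X) ^ 2 * Ring.inverse (qPochInf (-X) ^ 2)) * hpow + hinv
  rw [mk_moment, hpre, ← crankMap_mul_qPochInf_sq hS]
  linear_combination (-(partsGenFun (1 : ℤ) ^ k *
    crankMap j (partsGenFun (T 1) * partsGenFun (T (-1))))) * hinv

end KCrank

theorem mainTheorem2 (j k : ℕ) (hk : 2 ≤ k) :
    (Summable (fun n : KCrank.WeakTuple j => KCrank.weakTerm n.1) ∧
      PowerSeries.mk (fun n : ℕ => KCrank.moment j hk n) =
        KCrank.prefactor k * ∑' n : KCrank.WeakTuple j, KCrank.weakTerm n.1) ∧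
    (Summable (fun m : KCrank.StrictTuple j => KCrank.strictTerm m.1) ∧
      PowerSeries.mk (fun n : ℕ => KCrank.moment j hk n) =
        KCrank.prefactor k * ∑' m : KCrank.StrictTuple j, KCrank.strictTerm m.1) := by
  obtain ⟨S, hweak, hstrict⟩ := KCrank.exists_hasSum_weakTerm_and_strictTerm j
  have h := KCrank.mk_moment_eq_prefactor_mul hk hweak
  exact ⟨⟨hweak.summable, by rw [hweak.tsum_eq, h]⟩,
    ⟨hstrict.summable, by rw [hstrict.tsum_eq, h]⟩⟩
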